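/- Let $A$ and $B$ be complex unital Banach algebras, and let $A\overline{\otimes}B$ be a Banach algebra that is the completion of the algebraic tensor product $A\otimes B$ with respect to a (submultiplicative) uniform crossnorm, i.e. a norm with $\|x\otimes y\|=\|x\|\,\|y\|$ for $x\in A$, $y\in B$ and $\|(S\otimes T)u\|\le\|S\|\,\|T\|\,\|u\|$ for all bounded linear operators $S$ on $A$, $T$ on $B$ and all $u\in A\otimes B$. An element $c$ of a unital Banach algebra $C$ is Drazin invertible if there are $d\in C$ and an integer $m\ge 0$ with $c^m d c=c^m$, $dcd=d$, $cd=dc$. Put $\sigma_{DR}(c)=\{\lambda\in\mathbb{C}: c-\lambda \text{ is not Drazin invertible}\}$ and $\rho_{DR}(c)=\mathbb{C}\setminus\sigma_{DR}(c)$; let $\sigma(c)$ be the spectrum of $c$, and let $\Pi(c)$ be the set of poles of $c$, that is, the set of isolated points of $\sigma(c)$ at which the resolvent function $\lambda\mapsto(\lambda-c)^{-1}$ has a pole (of some order $p\ge 1$). Let $a\in A$, $b\in B$ and $\mathbb{D}=\sigma(a)\,\sigma_{DR}(b)\cup\sigma_{DR}(a)\,\sigma(b)$, where a product of sets is the set of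 all products of their elements. (i) If $\sigma(a)=\Pi(a)\neq\{0\}$ and $\sigma_{DR}(b)\neq\emptyset$, then $\sigma_{DR}(a\otimes b)=\mathbb{D}$ if and only if $0\notin\Pi(a)$ or $0\notin\rho_{DR}(b)$. (ii) If $\sigma_{DR}(a)\neq\emptyset$ and $\sigma(b)=\Pi(b)\neq\{0\}$, then $\sigma_{DR}(a\otimes b)=\mathbb{D}$ if and only if $0\notin\rho_{DR}(a)$ or $0\notin\Pi(b)$. -/

import Mathlib

open scoped TensorProduct Pointwise Topology

noncomputable section

/-- `a` is Drazin invertible: there are `b` and `m` with `aᵐba = aᵐ`, `bab = b` and `ab = ba`. -/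
def IsDrazinInvertible {R : Type*} [Ring R] (a : R) : Prop :=
  ∃ (b : R) (m : ℕ), a ^ m * b * a = a ^ m ∧ b * a * b = b ∧ a * b = b * a

/-- The Drazin spectrum `σ_DR(a)`. -/
def drazinSpectrum {A : Type*} [Ring A] [Algebra ℂ A] (a : A) : Set ℂ :=
  {z | ¬ IsDrazinInvertible (a - algebraMap ℂ A z)}

/-- The Drazin resolvent set `ρ_DR(a)`. -/
def drazinResolventSet {A : Type*} [Ring A] [Algebra ℂ A] (a : A) : Set ℂ :=
  {z | IsDrazinInvertible (a - algebraMap ℂ A z)}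

/-- The isolated points of a set of complex numbers. -/
def isoPoints (K : Set ℂ) : Set ℂ := K \ derivedSet K

/-- The set `Π(a)` of poles of the resolvent of `a`: the isolated points of the spectrum at which
the resolvent function `z ↦ (z - a)⁻¹` has a pole of some order `p ≥ 1`, that is, is meromorphic
of order `-p`. -/
def poles {A : Type*} [NormedRing A] [NormedAlgebra ℂ A] (a : A) : Set ℂ :=
  {z | z ∈ isoPoints (spectrum ℂ a) ∧ MeromorphicAt (resolvent a : ℂ → A) z ∧
    ∃ p : ℕ, 1 ≤ p ∧ meromorphicOrderAt (resolvent a : ℂ → A) z = ((-(p : ℤ) : ℤ) : WithTop ℤ)}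

/-- The set `𝔻 = σ(a) σ_DR(b) ∪ σ_DR(a) σ(b)`. -/
def drazinProductSet {A B : Type*} [Ring A] [Algebra ℂ A] [Ring B] [Algebra ℂ B]
    (a : A) (b : B) : Set ℂ :=
  spectrum ℂ a * drazinSpectrum b ∪ drazinSpectrum a * spectrum ℂ b

/-- A uniform crossnorm on the algebraic tensor product `A ⊗ B` of two normed algebras whose
completion is a Banach algebra: a submultiplicative norm on `A ⊗ B` (`AlgebraNorm`) with
`‖a ⊗ b‖ = ‖a‖ ‖b‖` and `‖(S ⊗ T) u‖ ≤ ‖S‖ ‖T‖ ‖u‖` for all bounded linear operators `S` on `A`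
and `T` on `B`. -/
structure UniformCrossnorm (A B : Type*) [NormedRing A] [NormedAlgebra ℂ A]
    [NormedRing B] [NormedAlgebra ℂ B] extends AlgebraNorm ℂ (A ⊗[ℂ] B) where
  /-- The crossnorm property. -/
  map_tmul' : ∀ (a : A) (b : B), toFun (a ⊗ₜ[ℂ] b) = ‖a‖ * ‖b‖
  /-- Uniformity. -/
  map_map_le' : ∀ (S : A →L[ℂ] A) (T : B →L[ℂ] B) (u : A ⊗[ℂ] B),
    toFun (TensorProduct.map (S : A →ₗ[ℂ] A) (T : B →ₗ[ℂ] B) u) ≤ ‖S‖ * ‖T‖ * toFun u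

namespace UniformCrossnorm

variable {A B : Type*} [NormedRing A] [NormedAlgebra ℂ A] [NormedRing B] [NormedAlgebra ℂ B]

/-- The algebra `A ⊗ B`, to be normed by `α`. -/
def AlgTensor (_α : UniformCrossnorm A B) : Type _ := A ⊗[ℂ] B

variable (α : UniformCrossnorm A B)

instance : Ring α.AlgTensor := inferInstanceAs (Ring (A ⊗[ℂ] B))

instance : Algebra ℂ α.AlgTensor := inferInstanceAs (Algebra ℂ (A ⊗[ℂ] B))

/-- `A ⊗ B` normed by `α`. -/
instance : NormedRing α.AlgTensor where
  __ : Ring α.AlgTensor := inferInstance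
  __ := AddGroupNorm.toNormedAddCommGroup α.toRingNorm.toAddGroupNorm
  norm_mul_le u v := α.mul_le' u v

instance : NormedAlgebra ℂ α.AlgTensor where
  __ : Algebra ℂ α.AlgTensor := inferInstance
  norm_smul_le z u := (α.smul' z u).le

/-- The identity map from `A ⊗ B` to `A ⊗ B` normed by `α`. -/
def ofTensor : A ⊗[ℂ] B ≃ₐ[ℂ] α.AlgTensor := AlgEquiv.refl

/-- The Banach algebra `A ⊗̄ B`: the completion of `A ⊗ B` with respect to `α`. -/
abbrev BanachTensor : Type _ := UniformSpace.Completion α.AlgTensor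

instance : NormedAlgebra ℂ α.BanachTensor where
  __ : Algebra ℂ α.BanachTensor := inferInstance
  norm_smul_le := norm_smul_le

/-- The elementary tensor `a ⊗ b` in `A ⊗̄ B`. -/
def tmul (a : A) (b : B) : α.BanachTensor :=
  (α.ofTensor (a ⊗ₜ[ℂ] b) : UniformSpace.Completion α.AlgTensor)

end UniformCrossnorm

end

/-!
The condition `σ(a) = Π(a)` forces `a` to be algebraic: `σ(a)` is compact without accumulation
points in it, hence finite, and for `P = ∏ (X - s) ^ n s`, with `n s` the order of the pole `s`, the
function `z ↦ (z - a)⁻¹ P(a)` extends to an entire function vanishing at infinity, so `P(a) = 0`.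

For algebraic `a`, the set `σ_DR(a ⊗ b)` is the union of the sets `σ_DR(s b)` over `s ∈ σ(a)`. With
`x = a ⊗ b - z` and `t s = 1 ⊗ (s b - z)`, a product of factors `x - t s` vanishes; as `x` agrees
with `t s` modulo `x - t s`, it is Drazin invertible if all the `t s` are. Conversely, if `e ≠ 0`
and `a e = s e`, then a slice map `f ⊗ id` with `f e = 1` turns a Drazin inverse of `x` into a
witness of the Drazin invertibility of `s b - z`.

As `σ_DR(a) = ∅` and `σ_DR(0) = ∅`, the question becomes whether `(σ(a) \ {0}) σ_DR(b)` is all of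
`σ(a) σ_DR(b)`.
-/

section DrazinInverse

variable {R : Type*} [Ring R] {x y d w : R} {m : ℕ}

theorem IsDrazinInvertible.of_pow_succ_mul_eq (hc : Commute x w) (h : x ^ (m + 1) * w = x ^ m) :
    IsDrazinInvertible x := by
  have key (k : ℕ) : x ^ (m + k) * w ^ k = x ^ m := by
    induction k with
    | zero => simp
    | succ k ih =>
      calc x ^ (m + (k + 1)) * w ^ (k + 1) = x ^ k * (x ^ (m + 1) * w) * w ^ k := by
            rw [pow_succ' w, show m + (k + 1) = k + (m + 1) by ring, pow_add x k]
            simp only [mul_assoc]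
        _ = x ^ m := by rw [h, ← pow_add, add_comm k m, ih]
  have hxw (i j : ℕ) : Commute (x ^ i) (w ^ j) := hc.pow_pow i j
  have hdx : x ^ m * w ^ (m + 1) * x = x ^ (m + 1) * w ^ (m + 1) := by
    rw [mul_assoc, ← (hc.pow_right (m + 1)).eq, ← mul_assoc, ← pow_succ]
  refine ⟨x ^ m * w ^ (m + 1), m, ?_, ?_, ?_⟩
  · rw [mul_assoc, hdx, ← mul_assoc, ← pow_add, key]
  · rw [hdx, mul_assoc, ← mul_assoc (w ^ (m + 1)), ← (hxw m (m + 1)).eq, mul_assoc, ← mul_assoc,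
      ← pow_add, show m + 1 + m = m + (m + 1) by ring, ← mul_assoc, key]
  · rw [hdx, ← mul_assoc, ← pow_succ']

theorem commute_of_isDrazinInverse (hm : x ^ m * d * x = x ^ m) (hd : d * x * d = d)
    (hxd : Commute x d) (hxy : Commute x y) : Commute d y := by
  obtain ⟨p, hp⟩ : ∃ p, p = x * d := ⟨_, rfl⟩
  have hdp : d * p = d := by rw [hp, ← mul_assoc, hd]
  have hpd : p * d = d := by rw [hp, hxd.eq, hd]
  have hpp : IsIdempotentElem p := by
    rw [IsIdempotentElem]
    nth_rewrite 1 [hp]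
    rw [mul_assoc, hdp, ← hp]
  have hp_left : p = x ^ (m + 1) * d ^ (m + 1) := by
    rw [← hxd.mul_pow, ← hp, hpp.pow_succ_eq]
  have hp_right : p = d ^ (m + 1) * x ^ (m + 1) := hp_left.trans (hxd.pow_pow _ _).eq
  have hpx : Commute p x := hp ▸ (Commute.refl x).mul_left hxd.symm
  have hxp : x ^ (m + 1) * p = x ^ (m + 1) := by
    rw [pow_succ', mul_assoc, hp, hxd.eq, ← mul_assoc _ d, hm]
  have hpx' : p * x ^ (m + 1) = x ^ (m + 1) := by rw [(hpx.pow_right _).eq, hxp]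
  have hxy' : Commute (x ^ (m + 1)) y := hxy.pow_left _
  have hpy_left : p * y = p * y * p := by
    calc p * y = d ^ (m + 1) * (y * x ^ (m + 1)) := by rw [hp_right, mul_assoc, hxy'.eq]
      _ = d ^ (m + 1) * (y * x ^ (m + 1)) * p := by simp only [mul_assoc, hxp]
      _ = p * y * p := by rw [← hxy'.eq, ← mul_assoc, ← hp_right]
  have hpy_right : y * p = p * y * p := by
    calc y * p = x ^ (m + 1) * y * d ^ (m + 1) := by rw [hp_left, ← mul_assoc, hxy'.eq]
      _ = p * (x ^ (m + 1) * y * d ^ (m + 1)) := by simp only [← mul_assoc, hpx']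
      _ = p * y * p := by rw [hxy'.eq, mul_assoc y, ← hp_left, mul_assoc]
  have hpy : p * y = y * p := hpy_left.trans hpy_right.symm
  calc d * y = d * (p * y) := by rw [← mul_assoc, hdp]
    _ = d * y * x * d := by rw [hpy, hp]; simp only [mul_assoc]
    _ = p * y * d := by rw [mul_assoc d, ← hxy.eq, hp, hxd.eq]; simp only [mul_assoc]
    _ = y * d := by rw [hpy, mul_assoc, hpd]

theorem IsDrazinInvertible.map {S : Type*} [Ring S] (f : R →+* S) (h : IsDrazinInvertible x) :
    IsDrazinInvertible (f x) := by
  obtain ⟨d, m, hm, hd, hxd⟩ := h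
  exact ⟨f d, m, by rw [← map_pow, ← map_mul, ← map_mul, hm], by rw [← map_mul, ← map_mul, hd],
    by rw [← map_mul, hxd, map_mul]⟩

theorem isDrazinInvertible_of_divisionRing {K : Type*} [DivisionRing K] (x : K) :
    IsDrazinInvertible x := by
  rcases eq_or_ne x 0 with rfl | hx
  · exact ⟨0, 1, by simp, by simp, by simp⟩
  · exact ⟨x⁻¹, 0, by simp [hx], by simp [hx], by simp [hx]⟩

section Field

variable {𝕜 : Type*} [Field 𝕜] [Algebra 𝕜 R] {c : 𝕜}

theorem IsDrazinInvertible.smul (h : IsDrazinInvertible x) (hc : c ≠ 0) :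
    IsDrazinInvertible (c • x) := by
  obtain ⟨d, m, hm, hd, hxd⟩ := h
  exact ⟨c⁻¹ • d, m, by simp [smul_pow, smul_smul, hc, hm], by simp [smul_smul, hc, hd],
    by simp [smul_smul, hc, hxd]⟩

theorem isDrazinInvertible_smul_iff (hc : c ≠ 0) :
    IsDrazinInvertible (c • x) ↔ IsDrazinInvertible x :=
  ⟨fun h => by simpa [smul_smul, hc] using h.smul (inv_ne_zero hc), fun h => h.smul hc⟩

end Field

theorem IsDrazinInvertible.of_coe_centralizer {𝕜 : Type*} [CommRing 𝕜] [Algebra 𝕜 R] {s : Set R}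
    {x : Subalgebra.centralizer 𝕜 s} (h : IsDrazinInvertible (x : R)) : IsDrazinInvertible x := by
  obtain ⟨d, m, hm, hd, hxd⟩ := h
  have hds : d ∈ Subalgebra.centralizer 𝕜 s := fun y hy =>
    (commute_of_isDrazinInverse hm hd hxd (x.2 y hy).symm).symm
  exact ⟨⟨d, hds⟩, m, Subtype.ext hm, Subtype.ext hd, Subtype.ext hxd⟩

end DrazinInverse

section Commutative

variable {R : Type*} [CommRing R] {x : R}

theorem isDrazinInvertible_mk_iff {I : Ideal R} :
    IsDrazinInvertible (Ideal.Quotient.mk I x) ↔ ∃ (m : ℕ) (w : R), x ^ m * (1 - x * w) ∈ I := by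
  simp only [← Ideal.Quotient.eq_zero_iff_mem, map_mul, map_sub, map_pow, map_one]
  constructor
  · rintro ⟨d, m, hm, -, -⟩
    obtain ⟨w, rfl⟩ := Ideal.Quotient.mk_surjective d
    exact ⟨m, w, by linear_combination -hm⟩
  · rintro ⟨m, w, h⟩
    exact .of_pow_succ_mul_eq (.all _ (Ideal.Quotient.mk I w)) (by linear_combination -h)

theorem IsDrazinInvertible.mk_mul {I J : Ideal R} (hI : IsDrazinInvertible (Ideal.Quotient.mk I x))
    (hJ : IsDrazinInvertible (Ideal.Quotient.mk J x)) :
    IsDrazinInvertible (Ideal.Quotient.mk (I * J) x) := by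
  obtain ⟨m, v, hv⟩ := isDrazinInvertible_mk_iff.1 hI
  obtain ⟨n, w, hw⟩ := isDrazinInvertible_mk_iff.1 hJ
  refine isDrazinInvertible_mk_iff.2 ⟨m + n, v + w - x * v * w, ?_⟩
  convert Ideal.mul_mem_mul hv hw using 1
  ring

theorem isDrazinInvertible_mk_multiset_prod {S : Multiset (Ideal R)}
    (hS : ∀ I ∈ S, IsDrazinInvertible (Ideal.Quotient.mk I x)) :
    IsDrazinInvertible (Ideal.Quotient.mk S.prod x) := by
  induction S using Multiset.induction_on with
  | empty => exact isDrazinInvertible_mk_iff.2 ⟨0, 0, by simp⟩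
  | cons I S ih =>
    rw [Multiset.forall_mem_cons] at hS
    rw [Multiset.prod_cons]
    exact hS.1.mk_mul (ih hS.2)

theorem isDrazinInvertible_of_prod_sub_eq_zero {S : Multiset R}
    (hS : ∀ t ∈ S, IsDrazinInvertible t) (hprod : (S.map (x - ·)).prod = 0) :
    IsDrazinInvertible x := by
  -- `x` agrees with `t` modulo the ideal `(x - t)`, and the product of these ideals is zero.
  have hmk : IsDrazinInvertible
      (Ideal.Quotient.mk ((S.map (x - ·)).map fun y => Ideal.span {y}).prod x) := by
    refine isDrazinInvertible_mk_multiset_prod fun I hI => ?_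
    simp only [Multiset.mem_map, exists_exists_and_eq_and] at hI
    obtain ⟨t, ht, rfl⟩ := hI
    rw [(Ideal.Quotient.mk_eq_mk_iff_sub_mem x t).2 (Ideal.mem_span_singleton_self _)]
    exact (hS t ht).map _
  rw [Ideal.multiset_prod_span_singleton, hprod] at hmk
  obtain ⟨m, w, h⟩ := isDrazinInvertible_mk_iff.1 hmk
  rw [Ideal.mem_span_singleton, zero_dvd_iff] at h
  exact .of_pow_succ_mul_eq (.all x w) (by linear_combination -h)

open Polynomial

theorem isDrazinInvertible_mul_sub_algebraMap_of_comm {𝕜 : Type*} [Field 𝕜] [Algebra 𝕜 R]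
    {a b : R} {p : 𝕜[X]} (hp : p.Splits) (hmonic : p.Monic) (ha : aeval a p = 0) {z : 𝕜}
    (h : ∀ s ∈ p.roots, IsDrazinInvertible (s • b - algebraMap 𝕜 R z)) :
    IsDrazinInvertible (a * b - algebraMap 𝕜 R z) := by
  refine isDrazinInvertible_of_prod_sub_eq_zero
    (S := p.roots.map fun s => s • b - algebraMap 𝕜 R z)
    (by simpa only [Multiset.forall_mem_map_iff] using h) ?_
  have hsub (s : 𝕜) : a * b - algebraMap 𝕜 R z - (s • b - algebraMap 𝕜 R z) =
      aeval a (X - C s) * b := by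
    simp only [map_sub, aeval_X, aeval_C, Algebra.smul_def]
    ring
  rw [hp.eq_prod_roots_of_monic hmonic, map_multiset_prod, Multiset.map_map] at ha
  simp only [Multiset.map_map, Function.comp_def, hsub, Multiset.prod_map_mul] at ha ⊢
  rw [ha, zero_mul]

end Commutative

section Integral

open Polynomial
open scoped IsMulCommutative

variable {𝕜 A : Type*} [Field 𝕜] [Ring A] [Algebra 𝕜 A] {a b : A} {s z : 𝕜}

theorem isDrazinInvertible_mul_sub_algebraMap {p : 𝕜[X]} (hp : p.Splits) (hmonic : p.Monic)
    (hab : Commute a b) (ha : aeval a p = 0)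
    (h : ∀ s ∈ p.roots, IsDrazinInvertible (s • b - algebraMap 𝕜 A z)) :
    IsDrazinInvertible (a * b - algebraMap 𝕜 A z) := by
  let C := Subalgebra.centralizer 𝕜 (Set.centralizer {a, b})
  have : IsMulCommutative C := .of_setLike_mul_comm <|
    Set.centralizer_centralizer_comm_of_comm <| by simp [hab.eq]
  let a' : C := ⟨a, Set.subset_centralizer_centralizer (by simp)⟩
  let b' : C := ⟨b, Set.subset_centralizer_centralizer (by simp)⟩
  have ha' : aeval a' p = 0 := (map_eq_zero_iff C.val Subtype.val_injective).1 <| by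
    rw [← aeval_algHom_apply]
    exact ha
  have hC : IsDrazinInvertible (a' * b' - algebraMap 𝕜 C z) :=
    isDrazinInvertible_mul_sub_algebraMap_of_comm hp hmonic ha' fun s hs =>
      .of_coe_centralizer (h s hs)
  exact hC.map (C.val : C →+* A)

theorem exists_mul_eq_smul_of_isRoot_minpoly (ha : IsIntegral 𝕜 a) (hs : (minpoly 𝕜 a).IsRoot s) :
    ∃ e ≠ 0, a * e = s • e := by
  obtain ⟨q, hq⟩ := dvd_iff_isRoot.2 hs
  have hq_monic : q.Monic := (monic_X_sub_C s).of_mul_monic_left (hq ▸ minpoly.monic ha)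
  refine ⟨aeval a q, minpoly.aeval_ne_zero_of_dvdNotUnit_minpoly ha hq_monic
    ⟨hq_monic.ne_zero, X - C s, not_isUnit_X_sub_C s, by rw [hq, mul_comm]⟩, ?_⟩
  have h0 : aeval a ((X - C s) * q) = 0 := hq ▸ minpoly.aeval 𝕜 a
  rwa [map_mul, map_sub, aeval_X, aeval_C, sub_mul, ← Algebra.smul_def, sub_eq_zero] at h0

theorem isRoot_minpoly_iff_mem_spectrum (ha : IsIntegral 𝕜 a) :
    (minpoly 𝕜 a).IsRoot s ↔ s ∈ spectrum 𝕜 a := by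
  constructor
  · intro hs hunit
    obtain ⟨e, he, hae⟩ := exists_mul_eq_smul_of_isRoot_minpoly ha hs
    refine he (hunit.mul_right_eq_zero.1 ?_)
    rw [sub_mul, hae, Algebra.smul_def, sub_self]
  · intro hs
    have : Nontrivial A := not_subsingleton_iff_nontrivial.1 fun _ => by simp at hs
    have := spectrum.subset_polynomial_aeval a (minpoly 𝕜 a) ⟨s, hs, rfl⟩
    rwa [minpoly.aeval, spectrum.zero_eq] at this

end Integral

section DrazinSpectrum

variable {A : Type*} [Ring A] [Algebra ℂ A]

theorem drazinSpectrum_map_subset {D : Type*} [Ring D] [Algebra ℂ D] (f : A →ₐ[ℂ] D) (a : A) :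
    drazinSpectrum (f a) ⊆ drazinSpectrum a := fun z hz hd => hz <| by
  simpa using hd.map (f : A →+* D)

theorem drazinSpectrum_algebraMap (s : ℂ) : drazinSpectrum (algebraMap ℂ A s) = ∅ := by
  refine Set.eq_empty_of_forall_notMem fun z hz => hz ?_
  rw [← map_sub]
  exact (isDrazinInvertible_of_divisionRing (s - z)).map _

theorem drazinSpectrum_smul {s : ℂ} (hs : s ≠ 0) (b : A) :
    drazinSpectrum (s • b) = s • drazinSpectrum b := by
  ext z
  rw [Set.mem_smul_set_iff_inv_smul_mem₀ hs, drazinSpectrum, drazinSpectrum, Set.mem_ofPred_eq,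
    Set.mem_ofPred_eq, ← isDrazinInvertible_smul_iff (inv_ne_zero hs), smul_sub, smul_smul,
    inv_mul_cancel₀ hs, one_smul, smul_eq_mul, map_mul, ← Algebra.smul_def]

theorem biUnion_drazinSpectrum_smul (K : Set ℂ) (b : A) :
    ⋃ s ∈ K, drazinSpectrum (s • b) = (K \ {0}) * drazinSpectrum b := by
  have h0 : drazinSpectrum (0 : A) = ∅ := by
    rw [← map_zero (algebraMap ℂ A), drazinSpectrum_algebraMap]
  rw [← smul_eq_mul, ← Set.iUnion_smul_set]
  ext z
  simp only [Set.mem_iUnion, exists_prop, Set.mem_sdiff, Set.mem_singleton_iff]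
  refine exists_congr fun s => ?_
  rcases eq_or_ne s 0 with rfl | hs
  · simp [h0]
  · simp [hs, drazinSpectrum_smul hs]

theorem drazinSpectrum_mul_subset {a b : A} (hab : Commute a b) (ha : IsIntegral ℂ a) :
    drazinSpectrum (a * b) ⊆ ⋃ s ∈ spectrum ℂ a, drazinSpectrum (s • b) := by
  intro z hz
  by_contra hcon
  simp only [Set.mem_iUnion, exists_prop, not_exists, not_and] at hcon
  refine hz (isDrazinInvertible_mul_sub_algebraMap (IsAlgClosed.splits _) (minpoly.monic ha) hab
    (minpoly.aeval ℂ a) fun s hs => not_not.1 (hcon s ?_))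
  exact (isRoot_minpoly_iff_mem_spectrum ha).1 (Polynomial.isRoot_of_mem_roots hs)

theorem drazinSpectrum_eq_empty_of_isIntegral {a : A} (ha : IsIntegral ℂ a) :
    drazinSpectrum a = ∅ := by
  refine Set.subset_empty_iff.1 ?_
  calc drazinSpectrum a ⊆ ⋃ s ∈ spectrum ℂ a, drazinSpectrum (s • (1 : A)) := by
        simpa only [mul_one] using drazinSpectrum_mul_subset (Commute.one_right a) ha
    _ = ∅ := by simp only [← Algebra.algebraMap_eq_smul_one, drazinSpectrum_algebraMap,
        Set.iUnion_empty]

theorem sdiff_singleton_zero_mul_eq_mul_iff {M : Type*} [MulZeroClass M] [NoZeroDivisors M]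
    {K L : Set M} (hK : K ≠ {0}) (hL : L.Nonempty) :
    (K \ {0}) * L = K * L ↔ 0 ∉ K ∨ 0 ∈ L := by
  constructor
  · intro h
    by_contra! ⟨hK0, hL0⟩
    obtain ⟨w, hw⟩ := hL
    have h0 : (0 : M) ∈ K * L := ⟨0, hK0, w, hw, zero_mul w⟩
    rw [← h] at h0
    obtain ⟨s, ⟨-, hs⟩, v, hv, hsv⟩ := h0
    rcases mul_eq_zero.1 hsv with rfl | rfl
    exacts [hs rfl, hL0 hv]
  · rintro (hK0 | hL0)
    · rw [Set.sdiff_singleton_eq_self hK0]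
    · refine (Set.mul_subset_mul_right Set.sdiff_subset).antisymm ?_
      rintro _ ⟨s, hs, w, hw, rfl⟩
      rcases eq_or_ne s 0 with rfl | hs0
      · obtain ⟨t, ht, ht0⟩ : ∃ t ∈ K, t ≠ 0 := by
          by_contra! hcon
          exact hK (Set.eq_singleton_iff_unique_mem.2 ⟨hs, hcon⟩)
        exact ⟨t, ⟨ht, ht0⟩, 0, hL0, by simp⟩
      · exact ⟨s, ⟨hs, hs0⟩, w, hw, rfl⟩

end DrazinSpectrum

section Slices

variable {A B D : Type*} [Ring A] [Algebra ℂ A] [Ring B] [Algebra ℂ B] [Ring D] [Algebra ℂ D]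

/-- The pair `i : A → D`, `j : B → D` has slices if every nonzero `e : A` admits a map `D → B`
that is a homomorphism of `B`-bimodules, `B` acting on `D` through `j`, and sends `i e` to `1`. It
abstracts the slice maps `f ⊗ id : A ⊗ B → B` of the functionals `f` on `A` with `f e = 1`. -/
def HasSlices (i : A →ₐ[ℂ] D) (j : B →ₐ[ℂ] D) : Prop :=
  ∀ e ≠ 0, ∃ E : D → B, E (i e) = 1 ∧ (∀ y u, E (j y * u) = y * E u) ∧
    ∀ y u, E (u * j y) = E u * y

variable {i : A →ₐ[ℂ] D} {j : B →ₐ[ℂ] D}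

theorem HasSlices.drazinSpectrum_smul_subset (hE : HasSlices i j)
    (hc : ∀ x y, Commute (i x) (j y)) {a e : A} {s : ℂ} (he : e ≠ 0) (hae : a * e = s • e)
    (b : B) : drazinSpectrum (s • b) ⊆ drazinSpectrum (i a * j b) := by
  intro z hz ⟨w, m, hm, hw, hxw⟩
  obtain ⟨E, hE1, hEl, hEr⟩ := hE e he
  set x := i a * j b - algebraMap ℂ D z with hx
  set y := s • b - algebraMap ℂ B z with hy
  have hxe : x * i e = j y * i e := by
    rw [hx, hy, map_sub, map_smul, AlgHom.commutes, sub_mul, sub_mul, mul_assoc, ← (hc e b).eq,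
      ← mul_assoc, ← map_mul, hae, map_smul, smul_mul_assoc, (hc e b).eq, smul_mul_assoc]
  have hby : Commute b y := ((Commute.refl b).smul_right s).sub_right (Algebra.commutes z b).symm
  have hxy : Commute x (j y) :=
    ((hc a y).mul_left (hby.map j)).sub_left (Algebra.commutes z (j y))
  have hxe_pow (k : ℕ) : x ^ k * i e = j (y ^ k) * i e := by
    induction k with
    | zero => simp
    | succ k ih =>
      rw [pow_succ', mul_assoc, ih, ← mul_assoc, map_pow, (hxy.pow_right k).eq, mul_assoc, hxe,
        ← mul_assoc, ← pow_succ, map_pow]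
  have hwy : Commute w (j y) := commute_of_isDrazinInverse hm hw hxw hxy
  have hyE : Commute y (E (w * i e)) := by
    rw [Commute, SemiconjBy, ← hEl, ← hEr, mul_assoc, (hc e y).eq, ← mul_assoc, ← mul_assoc,
      hwy.eq]
  refine hz (.of_pow_succ_mul_eq (m := m) hyE ?_)
  have hwx : w * x ^ (m + 1) = x ^ m := by
    rw [pow_succ, ← mul_assoc, ← (Commute.pow_left hxw m).eq, hm]
  calc y ^ (m + 1) * E (w * i e) = E (w * (j (y ^ (m + 1)) * i e)) := by
        rw [← hEl, map_pow, ← mul_assoc, ← mul_assoc, (hwy.pow_right _).eq]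
    _ = E (x ^ m * i e) := by rw [← hxe_pow, ← mul_assoc, hwx]
    _ = y ^ m := by rw [hxe_pow, hEl, hE1, mul_one]

theorem drazinSpectrum_map_mul_map (hc : ∀ x y, Commute (i x) (j y)) (hE : HasSlices i j) {a : A}
    (ha : IsIntegral ℂ a) (b : B) :
    drazinSpectrum (i a * j b) = (spectrum ℂ a \ {0}) * drazinSpectrum b := by
  rw [← biUnion_drazinSpectrum_smul]
  refine Set.Subset.antisymm ?_ (Set.iUnion₂_subset fun s hs => ?_)
  · refine (drazinSpectrum_mul_subset (hc a b) (ha.map i)).trans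
      (Set.biUnion_mono (AlgHom.spectrum_apply_subset i a) fun s _ => ?_)
    rw [← map_smul]
    exact drazinSpectrum_map_subset j (s • b)
  · obtain ⟨e, he, hae⟩ :=
      exists_mul_eq_smul_of_isRoot_minpoly ha ((isRoot_minpoly_iff_mem_spectrum ha).2 hs)
    exact hE.drazinSpectrum_smul_subset hc he hae b

end Slices

theorem eq_zero_of_analyticAt_of_tendsto_cocompact {E : Type*} [NormedAddCommGroup E]
    [NormedSpace ℂ E] {f : ℂ → E}
    (hf : ∀ s, ∃ g, AnalyticAt ℂ g s ∧ f =ᶠ[𝓝[≠] s] g)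
    (hinf : ∀ᶠ z in Filter.cocompact ℂ, AnalyticAt ℂ f z)
    (hlim : Filter.Tendsto f (Filter.cocompact ℂ) (𝓝 0)) {z : ℂ} (hz : AnalyticAt ℂ f z) :
    f z = 0 := by
  set F := toMeromorphicNFOn f Set.univ with hF
  have hmer : MeromorphicOn f Set.univ := fun s _ => by
    obtain ⟨g, hg, hfg⟩ := hf s
    exact hg.meromorphicAt.congr hfg.symm
  have hF_entire : Differentiable ℂ F := fun s => by
    obtain ⟨g, hg, hfg⟩ := hf s
    have hF_nf := meromorphicNFOn_toMeromorphicNFOn f Set.univ (Set.mem_univ s)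
    refine (hF_nf.meromorphicOrderAt_nonneg_iff_analyticAt.1 ?_).differentiableAt
    rw [meromorphicOrderAt_congr
      ((hmer.toMeromorphicNFOn_eq_self_on_nhdsNE (Set.mem_univ s)).trans hfg)]
    exact hg.meromorphicOrderAt_nonneg
  have hF_eq {w : ℂ} (hw : AnalyticAt ℂ f w) : F w = f w := by
    rw [hF, toMeromorphicNFOn_eq_toMeromorphicNFAt hmer (Set.mem_univ w),
      toMeromorphicNFAt_eq_self.2 hw.meromorphicNFAt]
  rw [← hF_eq hz]
  refine hF_entire.apply_eq_of_tendsto_cocompact z (hlim.congr' ?_)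
  filter_upwards [hinf] with w hw using (hF_eq hw).symm

section Poles

variable {A : Type*} [NormedRing A] [NormedAlgebra ℂ A]

theorem exists_differentiable_resolvent_mul_sub_pow (a : A) (s : ℂ) (n : ℕ) :
    ∃ q : ℂ → A, Differentiable ℂ q ∧ ∀ z ∈ resolventSet ℂ a,
      resolvent a z * (a - algebraMap ℂ A s) ^ n = (z - s) ^ n • resolvent a z - q z := by
  induction n with
  | zero => exact ⟨0, differentiable_const _, by simp⟩
  | succ n ih =>
    obtain ⟨q, hq, hqz⟩ := ih
    refine ⟨fun z => (z - s) ^ n • 1 + q z * (a - algebraMap ℂ A s),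
      (((differentiable_id.sub_const s).pow n).smul_const 1).add (hq.mul_const _), fun z hz => ?_⟩
    have hR : resolvent a z * (a - algebraMap ℂ A s) = (z - s) • resolvent a z - 1 := by
      have hinv : resolvent a z * (algebraMap ℂ A z - a) = 1 := Ring.inverse_mul_cancel _ hz
      rw [← hinv, sub_smul, Algebra.smul_def, Algebra.smul_def, Algebra.commutes z,
        Algebra.commutes s, ← mul_sub, ← mul_sub, sub_sub_sub_cancel_left]
    rw [pow_succ, ← mul_assoc, hqz z hz, sub_mul, smul_mul_assoc, hR, smul_sub, smul_smul,
      ← pow_succ, sub_sub]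

variable [CompleteSpace A] {a : A}

theorem exists_analyticAt_resolvent_mul_sub_pow {s : ℂ} (hs : s ∈ poles a) :
    ∃ (n : ℕ) (g : ℂ → A), AnalyticAt ℂ g s ∧
      (fun z => resolvent a z * (a - algebraMap ℂ A s) ^ n) =ᶠ[𝓝[≠] s] g := by
  obtain ⟨⟨-, hiso⟩, hmer, n, -, hord⟩ := hs
  obtain ⟨g, hg, -, hRg⟩ := (meromorphicOrderAt_eq_int_iff hmer).1 hord
  obtain ⟨q, hq, hqz⟩ := exists_differentiable_resolvent_mul_sub_pow a s n
  have hres : ∀ᶠ z in 𝓝[≠] s, z ∈ resolventSet ℂ a := by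
    rw [mem_derivedSet, accPt_iff_frequently_nhdsNE, Filter.not_frequently] at hiso
    filter_upwards [hiso] with z hz using not_not.1 hz
  refine ⟨n, g - q, hg.sub (hq.analyticAt s), ?_⟩
  filter_upwards [hres, hRg, self_mem_nhdsWithin] with z hz hgz hzs
  have hzs' : z - s ≠ 0 := sub_ne_zero.2 hzs
  rw [hqz z hz, hgz, smul_smul, zpow_neg, zpow_natCast, mul_inv_cancel₀ (pow_ne_zero n hzs'),
    one_smul, Pi.sub_apply]

theorem analyticAt_resolvent {z : ℂ} (hz : z ∈ resolventSet ℂ a) :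
    AnalyticAt ℂ (resolvent a) z := by
  have hdiff : DifferentiableOn ℂ (resolvent a) (resolventSet ℂ a) := fun w hw =>
    (spectrum.hasDerivAt_resolvent_const_left hw).differentiableAt.differentiableWithinAt
  exact hdiff.analyticAt ((spectrum.isOpen_resolventSet a).mem_nhds hz)

theorem finite_spectrum_of_eq_poles (h : spectrum ℂ a = poles a) : (spectrum ℂ a).Finite := by
  by_contra hinf
  obtain ⟨z, hz, hacc⟩ :=
    Set.Infinite.exists_accPt_of_subset_isCompact hinf (spectrum.isCompact a) subset_rfl
  exact (h.subset hz).1.2 hacc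

open Polynomial in
theorem isIntegral_of_spectrum_eq_poles (h : spectrum ℂ a = poles a) : IsIntegral ℂ a := by
  have hfin := finite_spectrum_of_eq_poles h
  choose! n g hg hRg using fun s (hs : s ∈ spectrum ℂ a) =>
    exists_analyticAt_resolvent_mul_sub_pow (h.subset hs)
  set P : ℂ[X] := ∏ s ∈ hfin.toFinset, (X - C s) ^ n s
  set f : ℂ → A := fun z => resolvent a z * aeval a P with hf
  have hf_res {z : ℂ} (hz : z ∈ resolventSet ℂ a) : AnalyticAt ℂ f z :=
    (analyticAt_resolvent hz).mul analyticAt_const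
  have hf_removable (s : ℂ) : ∃ g, AnalyticAt ℂ g s ∧ f =ᶠ[𝓝[≠] s] g := by
    by_cases hs : s ∈ spectrum ℂ a
    · obtain ⟨P', hP'⟩ : (X - C s) ^ n s ∣ P :=
        Finset.dvd_prod_of_mem _ (hfin.mem_toFinset.2 hs)
      refine ⟨fun z => g s z * aeval a P', (hg s hs).mul analyticAt_const, ?_⟩
      filter_upwards [hRg s hs] with z hz
      rw [hf, ← hz, hP', map_mul, map_pow, map_sub, aeval_X, aeval_C, mul_assoc]
    · exact ⟨f, hf_res (not_not.1 hs), .rfl⟩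
  have hf_inf : ∀ᶠ z in Filter.cocompact ℂ, AnalyticAt ℂ f z := by
    filter_upwards [(spectrum.isCompact (𝕜 := ℂ) a).compl_mem_cocompact] with z hz
      using hf_res (not_not.1 hz)
  have hf_lim : Filter.Tendsto f (Filter.cocompact ℂ) (𝓝 0) := by
    rw [← Metric.cobounded_eq_cocompact]
    simpa using (spectrum.resolvent_tendsto_cobounded (𝕜 := ℂ) a).mul_const (aeval a P)
  obtain ⟨z, hz⟩ := hfin.exists_notMem
  have hfz : resolvent a z * aeval a P = 0 :=
    eq_zero_of_analyticAt_of_tendsto_cocompact hf_removable hf_inf hf_lim (hf_res (not_not.1 hz))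
  have hunit : IsUnit (resolvent a z) := spectrum.isUnit_resolvent.1 (not_not.1 hz)
  exact ⟨P, monic_prod_of_monic _ _ fun s _ => (monic_X_sub_C s).pow _,
    hunit.mul_right_eq_zero.1 hfz⟩

end Poles

theorem drazinSpectrum_map_mul_map_eq_drazinProductSet_iff {A B D : Type*} [NormedRing A]
    [NormedAlgebra ℂ A] [CompleteSpace A] [Ring B] [Algebra ℂ B] [Ring D] [Algebra ℂ D]
    {i : A →ₐ[ℂ] D} {j : B →ₐ[ℂ] D} (hc : ∀ x y, Commute (i x) (j y)) (hE : HasSlices i j)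
    {a : A} {b : B} (ha : spectrum ℂ a = poles a) (ha0 : poles a ≠ {0})
    (hb : (drazinSpectrum b).Nonempty) :
    drazinSpectrum (i a * j b) = drazinProductSet a b ↔
      0 ∉ poles a ∨ 0 ∉ drazinResolventSet b := by
  have ha_int : IsIntegral ℂ a := isIntegral_of_spectrum_eq_poles ha
  have hres : 0 ∉ drazinResolventSet b ↔ 0 ∈ drazinSpectrum b := Iff.rfl
  rw [drazinSpectrum_map_mul_map hc hE ha_int, drazinProductSet,
    drazinSpectrum_eq_empty_of_isIntegral ha_int, Set.empty_mul, Set.union_empty, hres, ha,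
    sdiff_singleton_zero_mul_eq_mul_iff ha0 hb]

theorem exists_bounded_slice {A B : Type*} [NormedRing A] [NormedAlgebra ℂ A] [NormedRing B]
    [NormedAlgebra ℂ B] {N : A ⊗[ℂ] B → ℝ}
    (hN_tmul : ∀ x y, N (x ⊗ₜ y) = ‖x‖ * ‖y‖)
    (hN_map : ∀ (S : A →L[ℂ] A) (T : B →L[ℂ] B) u,
      N (TensorProduct.map (S : A →ₗ[ℂ] A) (T : B →ₗ[ℂ] B) u) ≤ ‖S‖ * ‖T‖ * N u)
    {e : A} (he : e ≠ 0) :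
    ∃ (L : A ⊗[ℂ] B →ₗ[ℂ] B) (K : ℝ), L (e ⊗ₜ 1) = 1 ∧ (∀ u, ‖L u‖ ≤ K * N u) ∧
      (∀ y u, L ((1 ⊗ₜ y) * u) = y * L u) ∧ ∀ y u, L (u * (1 ⊗ₜ y)) = L u * y := by
  obtain ⟨f, hf⟩ := SeparatingDual.exists_eq_one (R := ℂ) he
  let L : A ⊗[ℂ] B →ₗ[ℂ] B :=
    (TensorProduct.lid ℂ B : ℂ ⊗[ℂ] B →ₗ[ℂ] B) ∘ₗ (f : A →ₗ[ℂ] ℂ).rTensor B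
  have hL (x : A) (y : B) : L (x ⊗ₜ y) = f x • y := by simp [L]
  have hmap (u : A ⊗[ℂ] B) : TensorProduct.map (f.smulRight e : A →ₗ[ℂ] A)
      (ContinuousLinearMap.id ℂ B : B →ₗ[ℂ] B) u = e ⊗ₜ[ℂ] L u := by
    induction u with
    | zero => simp
    | tmul x y => simp [hL, TensorProduct.smul_tmul]
    | add u v hu hv => rw [map_add, map_add, hu, hv, TensorProduct.tmul_add]
  refine ⟨L, ‖f.smulRight e‖ * ‖ContinuousLinearMap.id ℂ B‖ / ‖e‖, by rw [hL, hf, one_smul],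
    fun u => ?_, fun y u => ?_, fun y u => ?_⟩
  · have h := hN_map (f.smulRight e) (.id ℂ B) u
    rw [hmap, hN_tmul] at h
    rwa [div_mul_eq_mul_div, le_div_iff₀ (norm_pos_iff.2 he), mul_comm]
  · induction u with
    | zero => simp
    | tmul x z => simp [hL]
    | add u v hu hv => rw [mul_add, map_add, map_add, hu, hv, mul_add]
  · induction u with
    | zero => simp
    | tmul x z => simp [hL]
    | add u v hu hv => rw [add_mul, map_add, map_add, hu, hv, add_mul]

namespace UniformCrossnorm

variable {A B : Type*} [NormedRing A] [NormedAlgebra ℂ A] [NormedRing B] [NormedAlgebra ℂ B]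
  (α : UniformCrossnorm A B)

/-- The inclusion of `A ⊗ B` in its completion. -/
noncomputable def coeAlgHom : A ⊗[ℂ] B →ₐ[ℂ] α.BanachTensor where
  __ := (UniformSpace.Completion.coeRingHom : α.AlgTensor →+* α.BanachTensor).comp
    (α.ofTensor : A ⊗[ℂ] B →+* α.AlgTensor)
  commutes' _ := rfl

theorem coeAlgHom_tmul (a : A) (b : B) : α.coeAlgHom (a ⊗ₜ[ℂ] b) = α.tmul a b := rfl

/-- The embedding `x ↦ x ⊗ 1` of `A` in `A ⊗̄ B`. -/
noncomputable def inclLeft : A →ₐ[ℂ] α.BanachTensor :=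
  α.coeAlgHom.comp Algebra.TensorProduct.includeLeft

/-- The embedding `y ↦ 1 ⊗ y` of `B` in `A ⊗̄ B`. -/
noncomputable def inclRight : B →ₐ[ℂ] α.BanachTensor :=
  α.coeAlgHom.comp Algebra.TensorProduct.includeRight

theorem inclLeft_mul_inclRight (a : A) (b : B) : α.inclLeft a * α.inclRight b = α.tmul a b := by
  rw [inclLeft, inclRight, AlgHom.comp_apply, AlgHom.comp_apply, ← map_mul, ← coeAlgHom_tmul]
  simp

theorem commute_inclLeft_inclRight (a : A) (b : B) : Commute (α.inclLeft a) (α.inclRight b) := by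
  have h : Commute (a ⊗ₜ[ℂ] (1 : B)) ((1 : A) ⊗ₜ[ℂ] b) := by simp [Commute, SemiconjBy]
  exact h.map α.coeAlgHom

theorem exists_bimodule_extension {F : Type*} [NormedRing F] [NormedAlgebra ℂ F] [CompleteSpace F]
    (j : F →ₐ[ℂ] A ⊗[ℂ] B) (L : A ⊗[ℂ] B →ₗ[ℂ] F) (K : ℝ) (hK : ∀ u, ‖L u‖ ≤ K * α.toFun u)
    (hl : ∀ y u, L (j y * u) = y * L u) (hr : ∀ y u, L (u * j y) = L u * y) :
    ∃ E : α.BanachTensor → F, (∀ u, E (α.coeAlgHom u) = L u) ∧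
      (∀ y u, E (α.coeAlgHom (j y) * u) = y * E u) ∧
      ∀ y u, E (u * α.coeAlgHom (j y)) = E u * y := by
  let L' : α.AlgTensor →L[ℂ] F :=
    LinearMap.mkContinuous (L ∘ₗ (α.ofTensor.symm : α.AlgTensor →ₗ[ℂ] A ⊗[ℂ] B)) K hK
  let E : α.BanachTensor → F := UniformSpace.Completion.extension L'
  have hE : Continuous E := UniformSpace.Completion.continuous_extension
  have hE_coe (u : A ⊗[ℂ] B) : E (α.coeAlgHom u) = L u :=
    UniformSpace.Completion.extension_coe L'.uniformContinuous (α.ofTensor u)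
  refine ⟨E, hE_coe, fun y u => ?_, fun y u => ?_⟩
  · refine UniformSpace.Completion.induction_on u
      (isClosed_eq (hE.comp (continuous_const_mul _)) (hE.const_mul y)) fun v => ?_
    change E (_ * α.coeAlgHom (α.ofTensor.symm v)) = y * E (α.coeAlgHom (α.ofTensor.symm v))
    rw [← map_mul, hE_coe, hE_coe, hl]
  · refine UniformSpace.Completion.induction_on u
      (isClosed_eq (hE.comp (continuous_mul_const _)) (hE.mul_const y)) fun v => ?_
    change E (α.coeAlgHom (α.ofTensor.symm v) * _) = E (α.coeAlgHom (α.ofTensor.symm v)) * y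
    rw [← map_mul, hE_coe, hE_coe, hr]

theorem hasSlices_inclLeft_inclRight [CompleteSpace B] : HasSlices α.inclLeft α.inclRight := by
  intro e he
  obtain ⟨L, K, hL1, hK, hl, hr⟩ := exists_bounded_slice α.map_tmul' α.map_map_le' he
  obtain ⟨E, hE, hEl, hEr⟩ :=
    α.exists_bimodule_extension Algebra.TensorProduct.includeRight L K hK hl hr
  exact ⟨E, (hE _).trans hL1, hEl, hEr⟩

theorem hasSlices_inclRight_inclLeft [CompleteSpace A] : HasSlices α.inclRight α.inclLeft := by
  intro e he
  let σ : B ⊗[ℂ] A ≃ₐ[ℂ] A ⊗[ℂ] B := Algebra.TensorProduct.comm ℂ B A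
  have hσ_map (S : B →L[ℂ] B) (T : A →L[ℂ] A) (u : B ⊗[ℂ] A) :
      σ (TensorProduct.map (S : B →ₗ[ℂ] B) (T : A →ₗ[ℂ] A) u) =
        TensorProduct.map (T : A →ₗ[ℂ] A) (S : B →ₗ[ℂ] B) (σ u) := by
    induction u with
    | zero => simp
    | tmul y x => simp [σ]
    | add u v hu hv => simp only [map_add, hu, hv]
  obtain ⟨L, K, hL1, hK, hl, hr⟩ := exists_bounded_slice (N := fun u => α.toFun (σ u))
    (fun y x => (α.map_tmul' x y).trans (mul_comm _ _))
    (fun S T u => by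
      rw [hσ_map, mul_comm ‖S‖]
      exact α.map_map_le' T S (σ u)) he
  obtain ⟨E, hE, hEl, hEr⟩ := α.exists_bimodule_extension Algebra.TensorProduct.includeLeft
    (L ∘ₗ (σ.symm : A ⊗[ℂ] B →ₗ[ℂ] B ⊗[ℂ] A)) K (fun u => by simpa using hK (σ.symm u))
    (fun x u => (congrArg L (map_mul σ.symm _ u)).trans (hl x (σ.symm u)))
    (fun x u => (congrArg L (map_mul σ.symm u _)).trans (hr x (σ.symm u)))
  exact ⟨E, (hE _).trans hL1, hEl, hEr⟩

end UniformCrossnorm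

theorem drazinProductSet_comm {A B : Type*} [Ring A] [Algebra ℂ A] [Ring B] [Algebra ℂ B]
    (a : A) (b : B) : drazinProductSet a b = drazinProductSet b a := by
  rw [drazinProductSet, drazinProductSet, Set.union_comm, mul_comm, mul_comm (spectrum ℂ a)]

theorem theorem4p2 {A B : Type*} [NormedRing A] [NormedAlgebra ℂ A] [CompleteSpace A]
    [NormedRing B] [NormedAlgebra ℂ B] [CompleteSpace B]
    (α : UniformCrossnorm A B) (a : A) (b : B) :
    (spectrum ℂ a = poles a → poles a ≠ {0} → (drazinSpectrum b).Nonempty →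
      (drazinSpectrum (α.tmul a b) = drazinProductSet a b ↔
        0 ∉ poles a ∨ 0 ∉ drazinResolventSet b)) ∧
    ((drazinSpectrum a).Nonempty → spectrum ℂ b = poles b → poles b ≠ {0} →
      (drazinSpectrum (α.tmul a b) = drazinProductSet a b ↔
        0 ∉ drazinResolventSet a ∨ 0 ∉ poles b)) := by
  refine ⟨fun ha ha0 hb => ?_, fun ha hb hb0 => ?_⟩
  · rw [← α.inclLeft_mul_inclRight]
    exact drazinSpectrum_map_mul_map_eq_drazinProductSet_iff α.commute_inclLeft_inclRight
      α.hasSlices_inclLeft_inclRight ha ha0 hb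
  · rw [← α.inclLeft_mul_inclRight, (α.commute_inclLeft_inclRight a b).eq, drazinProductSet_comm,
      or_comm]
    exact drazinSpectrum_map_mul_map_eq_drazinProductSet_iff
      (fun x y => (α.commute_inclLeft_inclRight y x).symm) α.hasSlices_inclRight_inclLeft hb hb0 ha
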